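/- Heyting arithmetic $\mathbf{HA}$ and epistemic arithmetic $\mathbf{EA}$ are formulated in a first-order language with equality whose function symbols are $0$, $s$, $+$, $\cdot$ and a symbol for every primitive recursive function (one for each primitive recursive definition). $\mathbf{HA}$ is intuitionistic first-order logic with equality, in natural deduction with primitive $\bot,\wedge,\vee,\supset,\exists,\forall$, together with the usual axioms for zero and successor, the defining equations of $+$, $\cdot$ and of all the primitive recursive function symbols, and the scheme of induction for all formulas. $\mathbf{EA}$ is the corresponding system over classical first-order $\mathbf{S4}$ with equality: formulas may also contain the modal operator $\Box$, induction is for all formulas of this larger language, the intuitionistic rule for $\bot$ is replaced by classical reductio ad absurdum, and the rules $\Box$-elimination (from $\Box A$ infer $A$) and $\Box$-introduction (from $A$ infer $\Box A$, provided that all open assumptions are of the form $\Box B$) are added; the equality rule (from $s=t$ and $A(s)$ infer $A(t)$) applies to all formulas. Write $\neg A$ for $A\supset\bot$ and $\Diamond A$ for $\neg\Box\neg A$. **Theorem 4.2.** The following are equivalent. 1. The epistemic Markov's rule $\mathsf{EMR}$ holds in $\mathbf{EA}$: for every binary primitive recursive function symbol $f$, with $R(x,y)$ the formula $f(x,y)=0$,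 if $\vdash_{\mathbf{EA}}\Box\forall x\,\Diamond\exists y\,R(x,y)$, then $\vdash_{\mathbf{EA}}\Box\forall x\,\exists y\,R(x,y)$. 2. Markov's rule $\mathsf{MR}$ holds in $\mathbf{HA}$: for every binary primitive recursive function symbol $f$, with $R(x,y)$ the formula $f(x,y)=0$, if $\vdash_{\mathbf{HA}}\forall x\,\neg\neg\exists y\,R(x,y)$, then $\vdash_{\mathbf{HA}}\forall x\,\exists y\,R(x,y)$. -/

import Mathlib

namespace EpistemicArithmetic

/-- Function symbols of arithmetic, by arity: the constants `0`, `s`, `+`, `·`, and a symbol for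
every definition of a primitive recursive function from these by projections, composition and
primitive recursion. -/
inductive FunSymb : ℕ → Type
  | zero : FunSymb 0
  | succ : FunSymb 1
  | add : FunSymb 2
  | mul : FunSymb 2
  | proj {n : ℕ} (i : Fin n) : FunSymb n
  | comp {k n : ℕ} (g : FunSymb k) (h : Fin k → FunSymb n) : FunSymb n
  | prec {n : ℕ} (g : FunSymb n) (h : FunSymb (n + 2)) : FunSymb (n + 1)

/-- The first-order signature of arithmetic. It has no relation symbols besides equality. -/
def signature : FirstOrder.Language.{0, 0} := ⟨FunSymb, fun _ => Empty⟩

/-- Terms, with variables named by natural numbers (de Bruijn indices). -/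
abbrev Tm : Type := signature.Term ℕ

namespace Tm

/-- The variable with index `i`. -/
def v (i : ℕ) : Tm := FirstOrder.Language.Term.var i

/-- The application of a function symbol. -/
def app {n : ℕ} (f : FunSymb n) (ts : Fin n → Tm) : Tm :=
  FirstOrder.Language.Term.func (L := signature) f ts

def zero : Tm := app FunSymb.zero ![]

def succ (t : Tm) : Tm := app FunSymb.succ ![t]

def add (t u : Tm) : Tm := app FunSymb.add ![t, u]

def mul (t u : Tm) : Tm := app FunSymb.mul ![t, u]

end Tm

/-- Formulas built from `⊥` and equations by `∧`, `∨`, `⊃`, `∃`, `∀` and unary modal operators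
`box m`, one for each `m : M`. The quantifiers bind the variable with index `0` (de Bruijn). -/
inductive Formula (M : Type) : Type
  | falsum : Formula M
  | eq (s t : Tm) : Formula M
  | and (A B : Formula M) : Formula M
  | or (A B : Formula M) : Formula M
  | imp (A B : Formula M) : Formula M
  | ex (A : Formula M) : Formula M
  | all (A : Formula M) : Formula M
  | box (m : M) (A : Formula M) : Formula M

/-- A substitution that has been pushed under a quantifier: the bound variable stays fixed. -/
def liftSubst (σ : ℕ → Tm) : ℕ → Tm
  | 0 => Tm.v 0
  | i + 1 => (σ i).relabel Nat.succ

namespace Formula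

variable {M : Type}

/-- Negation, `¬ A = (A ⊃ ⊥)`. -/
def neg (A : Formula M) : Formula M := imp A falsum

/-- Simultaneous capture-avoiding substitution of `σ i` for the free variable `i`. -/
def subst : Formula M → (ℕ → Tm) → Formula M
  | falsum, _ => falsum
  | eq s t, σ => eq (s.subst σ) (t.subst σ)
  | and A B, σ => and (A.subst σ) (B.subst σ)
  | or A B, σ => or (A.subst σ) (B.subst σ)
  | imp A B, σ => imp (A.subst σ) (B.subst σ)
  | ex A, σ => ex (A.subst (liftSubst σ))
  | all A, σ => all (A.subst (liftSubst σ))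
  | box m A, σ => box m (A.subst σ)

/-- The formula `A`, seen in a scope with one new variable `0`, which does not occur in it. -/
def shift (A : Formula M) : Formula M := A.subst fun i => Tm.v (i + 1)

/-- `A[t/x]`, where `x` is the variable `0`, and the variable `i + 1` is renamed back to `i`. -/
def inst (A : Formula M) (t : Tm) : Formula M :=
  A.subst fun
    | 0 => t
    | i + 1 => Tm.v i

/-- `A[s x/x]`, where `x` is the variable `0`; the other variables are unchanged. -/
def succInst (A : Formula M) : Formula M :=
  A.subst fun
    | 0 => Tm.succ (Tm.v 0)
    | i + 1 => Tm.v (i + 1)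

end Formula

/-- The non-logical axioms of arithmetic, as schemes over all terms, and the scheme of induction
for all formulas of the language. -/
inductive ArithAxiom {M : Type} : Formula M → Prop
  | succ_ne_zero (t : Tm) :
      ArithAxiom (Formula.neg (Formula.eq (Tm.succ t) Tm.zero))
  | succ_inj (t u : Tm) :
      ArithAxiom (Formula.imp (Formula.eq (Tm.succ t) (Tm.succ u)) (Formula.eq t u))
  | add_zero (t : Tm) :
      ArithAxiom (Formula.eq (Tm.add t Tm.zero) t)
  | add_succ (t u : Tm) :
      ArithAxiom (Formula.eq (Tm.add t (Tm.succ u)) (Tm.succ (Tm.add t u)))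
  | mul_zero (t : Tm) :
      ArithAxiom (Formula.eq (Tm.mul t Tm.zero) Tm.zero)
  | mul_succ (t u : Tm) :
      ArithAxiom (Formula.eq (Tm.mul t (Tm.succ u)) (Tm.add (Tm.mul t u) t))
  | proj {n : ℕ} (i : Fin n) (ts : Fin n → Tm) :
      ArithAxiom (Formula.eq (Tm.app (FunSymb.proj i) ts) (ts i))
  | comp {k n : ℕ} (g : FunSymb k) (h : Fin k → FunSymb n) (ts : Fin n → Tm) :
      ArithAxiom (Formula.eq (Tm.app (FunSymb.comp g h) ts)
        (Tm.app g fun j => Tm.app (h j) ts))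
  | prec_zero {n : ℕ} (g : FunSymb n) (h : FunSymb (n + 2)) (ts : Fin n → Tm) :
      ArithAxiom (Formula.eq (Tm.app (FunSymb.prec g h) (Matrix.vecCons Tm.zero ts))
        (Tm.app g ts))
  | prec_succ {n : ℕ} (g : FunSymb n) (h : FunSymb (n + 2)) (u : Tm) (ts : Fin n → Tm) :
      ArithAxiom (Formula.eq (Tm.app (FunSymb.prec g h) (Matrix.vecCons (Tm.succ u) ts))
        (Tm.app h (Matrix.vecCons u
          (Matrix.vecCons (Tm.app (FunSymb.prec g h) (Matrix.vecCons u ts)) ts))))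
  | induction (A : Formula M) :
      ArithAxiom (Formula.imp
        (Formula.and (A.inst Tm.zero) (Formula.all (Formula.imp A A.succInst)))
        (Formula.all A))

/-- Formulas of Heyting arithmetic: there is no modal operator. -/
abbrev HAFormula : Type := Formula Empty

/-- Formulas of epistemic arithmetic: there is exactly one modal operator. -/
abbrev EAFormula : Type := Formula Unit

/-- Heyting arithmetic in natural deduction: `HA Γ A` says that there is a derivation of `A`
with open assumptions among `Γ`. -/
inductive HA : List HAFormula → HAFormula → Prop
  | assume {Γ : List HAFormula} {A : HAFormula} : A ∈ Γ → HA Γ A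
  | weaken {Γ Δ : List HAFormula} {A : HAFormula} : Γ ⊆ Δ → HA Γ A → HA Δ A
  | andI {Γ : List HAFormula} {A B : HAFormula} : HA Γ A → HA Γ B → HA Γ (A.and B)
  | andE₀ {Γ : List HAFormula} {A B : HAFormula} : HA Γ (A.and B) → HA Γ A
  | andE₁ {Γ : List HAFormula} {A B : HAFormula} : HA Γ (A.and B) → HA Γ B
  | orI₀ {Γ : List HAFormula} {A B : HAFormula} : HA Γ A → HA Γ (A.or B)
  | orI₁ {Γ : List HAFormula} {A B : HAFormula} : HA Γ B → HA Γ (A.or B)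
  | orE {Γ : List HAFormula} {A B C : HAFormula} :
      HA Γ (A.or B) → HA (A :: Γ) C → HA (B :: Γ) C → HA Γ C
  | impI {Γ : List HAFormula} {A B : HAFormula} : HA (A :: Γ) B → HA Γ (A.imp B)
  | impE {Γ : List HAFormula} {A B : HAFormula} : HA Γ A → HA Γ (A.imp B) → HA Γ B
  | botI {Γ : List HAFormula} {A : HAFormula} : HA Γ Formula.falsum → HA Γ A
  | exI {Γ : List HAFormula} {A : HAFormula} (t : Tm) : HA Γ (A.inst t) → HA Γ A.ex
  | exE {Γ : List HAFormula} {A B : HAFormula} :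
      HA Γ A.ex → HA (A :: Γ.map Formula.shift) B.shift → HA Γ B
  | allI {Γ : List HAFormula} {A : HAFormula} : HA (Γ.map Formula.shift) A → HA Γ A.all
  | allE {Γ : List HAFormula} {A : HAFormula} (t : Tm) : HA Γ A.all → HA Γ (A.inst t)
  | eqI {Γ : List HAFormula} (t : Tm) : HA Γ (Formula.eq t t)
  | eqSub {Γ : List HAFormula} (A : HAFormula) {s t : Tm} :
      HA Γ (Formula.eq s t) → HA Γ (A.inst s) → HA Γ (A.inst t)
  | arith {Γ : List HAFormula} {A : HAFormula} : ArithAxiom A → HA Γ A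

namespace EAFormula

/-- The formula `□ A`. -/
def nec (A : EAFormula) : EAFormula := Formula.box () A

/-- The formula `◇ A = ¬ □ ¬ A`. -/
def poss (A : EAFormula) : EAFormula := (nec A.neg).neg

end EAFormula

/-- Epistemic arithmetic, that is, Peano arithmetic over first-order `S4` with equality, in
natural deduction: `EA Γ A` says that there is a derivation of `A` with open assumptions
among `Γ`. -/
inductive EA : List EAFormula → EAFormula → Prop
  | assume {Γ : List EAFormula} {A : EAFormula} : A ∈ Γ → EA Γ A
  | weaken {Γ Δ : List EAFormula} {A : EAFormula} : Γ ⊆ Δ → EA Γ A → EA Δ A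
  | andI {Γ : List EAFormula} {A B : EAFormula} : EA Γ A → EA Γ B → EA Γ (A.and B)
  | andE₀ {Γ : List EAFormula} {A B : EAFormula} : EA Γ (A.and B) → EA Γ A
  | andE₁ {Γ : List EAFormula} {A B : EAFormula} : EA Γ (A.and B) → EA Γ B
  | orI₀ {Γ : List EAFormula} {A B : EAFormula} : EA Γ A → EA Γ (A.or B)
  | orI₁ {Γ : List EAFormula} {A B : EAFormula} : EA Γ B → EA Γ (A.or B)
  | orE {Γ : List EAFormula} {A B C : EAFormula} :
      EA Γ (A.or B) → EA (A :: Γ) C → EA (B :: Γ) C → EA Γ C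
  | impI {Γ : List EAFormula} {A B : EAFormula} : EA (A :: Γ) B → EA Γ (A.imp B)
  | impE {Γ : List EAFormula} {A B : EAFormula} : EA Γ A → EA Γ (A.imp B) → EA Γ B
  | botC {Γ : List EAFormula} {A : EAFormula} : EA (A.neg :: Γ) Formula.falsum → EA Γ A
  | exI {Γ : List EAFormula} {A : EAFormula} (t : Tm) : EA Γ (A.inst t) → EA Γ A.ex
  | exE {Γ : List EAFormula} {A B : EAFormula} :
      EA Γ A.ex → EA (A :: Γ.map Formula.shift) B.shift → EA Γ B
  | allI {Γ : List EAFormula} {A : EAFormula} : EA (Γ.map Formula.shift) A → EA Γ A.all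
  | allE {Γ : List EAFormula} {A : EAFormula} (t : Tm) : EA Γ A.all → EA Γ (A.inst t)
  | eqI {Γ : List EAFormula} (t : Tm) : EA Γ (Formula.eq t t)
  | eqSub {Γ : List EAFormula} (A : EAFormula) {s t : Tm} :
      EA Γ (Formula.eq s t) → EA Γ (A.inst s) → EA Γ (A.inst t)
  | boxI {Γ : List EAFormula} {A : EAFormula} :
      (∀ B ∈ Γ, ∃ C : EAFormula, B = EAFormula.nec C) → EA Γ A → EA Γ (EAFormula.nec A)
  | boxE {Γ : List EAFormula} {A : EAFormula} : EA Γ (EAFormula.nec A) → EA Γ A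
  | arith {Γ : List EAFormula} {A : EAFormula} : ArithAxiom A → EA Γ A

/-- The formula `R(x, y)`, that is, `f(x, y) = 0`, where `x` is the variable `1` and `y` is the
variable `0`; so `∀ x ∃ y R(x, y)` is `(graphZero f).ex.all`. -/
def graphZero {M : Type} (f : FunSymb 2) : Formula M :=
  Formula.eq (Tm.app f ![Tm.v 1, Tm.v 0]) Tm.zero

/-- Markov's rule holds in Heyting arithmetic: for every binary primitive recursive function
symbol, if `∀ x ¬ ¬ ∃ y R(x, y)` is provable, then so is `∀ x ∃ y R(x, y)`. -/
def MarkovRule : Prop :=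
  ∀ f : FunSymb 2,
    HA [] (Formula.all (Formula.neg (Formula.neg (Formula.ex (graphZero f))))) →
      HA [] (Formula.all (Formula.ex (graphZero f)))

/-- The epistemic Markov's rule holds in epistemic arithmetic: for every binary primitive
recursive function symbol, if `□ ∀ x ◇ ∃ y R(x, y)` is provable, then so is
`□ ∀ x ∃ y R(x, y)`. -/
def EpistemicMarkovRule : Prop :=
  ∀ f : FunSymb 2,
    EA [] (EAFormula.nec (Formula.all (EAFormula.poss (Formula.ex (graphZero f))))) →
      EA [] (EAFormula.nec (Formula.all (Formula.ex (graphZero f))))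

end EpistemicArithmetic

/-! For each `f`, the premises of the two rules are equiprovable in their systems, and so are the
conclusions (`EA_all_poss_ex_iff`, `EA_all_ex_iff`). From HA to EA this is inclusion (`HA.toEA`),
plus reflection `□ A ⊃ A` for the modal premise. From EA to HA, erase `□` and apply Friedman's
negative translation with a parameter `C` in place of `⊥` (`EA.friedman`). Taking `C = ⊥` handles
the premise; `C = ∃ y R(x, y)` handles the conclusion. -/

namespace EpistemicArithmetic

/-! ### Substitution calculus -/

namespace Tm

theorem subst_v (t : Tm) : t.subst v = t := by
  induction t with
  | var i => rfl
  | func f ts ih => exact congrArg _ (funext ih)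

theorem subst_subst (t : Tm) (σ τ : ℕ → Tm) :
    (t.subst σ).subst τ = t.subst fun i => (σ i).subst τ := by
  induction t with
  | var i => rfl
  | func f ts ih => exact congrArg _ (funext ih)

theorem relabel_succ_subst_liftSubst (t : Tm) (τ : ℕ → Tm) :
    (t.relabel Nat.succ).subst (liftSubst τ) = (t.subst τ).relabel Nat.succ := by
  induction t with
  | var i => rfl
  | func f ts ih => exact congrArg _ (funext ih)

end Tm

theorem liftSubst_v : liftSubst Tm.v = Tm.v := by
  funext i
  cases i <;> rfl

theorem liftSubst_comp (σ τ : ℕ → Tm) :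
    (fun i => (liftSubst σ i).subst (liftSubst τ)) = liftSubst fun i => (σ i).subst τ := by
  funext i
  cases i with
  | zero => rfl
  | succ i => exact Tm.relabel_succ_subst_liftSubst _ _

namespace Formula

variable {M : Type}

theorem subst_v (A : Formula M) : A.subst Tm.v = A := by
  induction A <;> simp_all [subst, liftSubst_v, Tm.subst_v]

theorem subst_subst (A : Formula M) (σ τ : ℕ → Tm) :
    (A.subst σ).subst τ = A.subst fun i => (σ i).subst τ := by
  induction A generalizing σ τ <;> simp_all [subst, liftSubst_comp, Tm.subst_subst]

theorem shift_subst_liftSubst (A : Formula M) (σ : ℕ → Tm) :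
    A.shift.subst (liftSubst σ) = (A.subst σ).shift := by
  rw [shift, shift, subst_subst, subst_subst]
  congr 1
  funext i
  -- `liftSubst` renames by `relabel` and `shift` by `subst`; on terms the two agree.
  change (σ i).relabel Nat.succ = _
  induction σ i with
  | var i => rfl
  | func f ts ih => exact congrArg _ (funext ih)

theorem shift_inst (A : Formula M) (t : Tm) : A.shift.inst t = A := by
  rw [shift, inst, subst_subst]
  exact subst_v A

theorem shift_succInst (A : Formula M) : A.shift.succInst = A.shift := by
  rw [shift, succInst, subst_subst]
  rfl

/-- Lets a quantified formula, once shifted, be instantiated at the eigenvariable itself. -/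
theorem inst_shift_lift (A : Formula M) :
    (A.subst (liftSubst fun i => Tm.v (i + 1))).inst (Tm.v 0) = A := by
  rw [inst, subst_subst]
  refine Eq.trans ?_ (subst_v A)
  congr 1
  funext i
  cases i <;> rfl

/-! ### The two translations -/

/-- The inclusion of the formulas without modal operators into those with modal operators. -/
def ofHA : HAFormula → Formula M
  | falsum => falsum
  | eq s t => eq s t
  | and A B => and (ofHA A) (ofHA B)
  | or A B => or (ofHA A) (ofHA B)
  | imp A B => imp (ofHA A) (ofHA B)
  | ex A => ex (ofHA A)
  | all A => all (ofHA A)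

theorem ofHA_subst (A : HAFormula) (σ : ℕ → Tm) :
    (ofHA (A.subst σ) : Formula M) = (ofHA A).subst σ := by
  induction A generalizing σ with
  | box m => exact m.elim
  | _ => simp_all [subst, ofHA]

/-- The negative translation with `⊥` replaced by `C` and with the modal operators erased. -/
def friedman (C : HAFormula) : Formula M → HAFormula
  | falsum => C
  | eq s t => ((eq s t).imp C).imp C
  | and A B => and (friedman C A) (friedman C B)
  | or A B => (and ((friedman C A).imp C) ((friedman C B).imp C)).imp C
  | imp A B => imp (friedman C A) (friedman C B)
  -- `C` may have free variables, so it is shifted under each binder.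
  | ex A => (all ((friedman C.shift A).imp C.shift)).imp C
  | all A => all (friedman C.shift A)
  | box _ A => friedman C A

theorem friedman_subst (A : Formula M) (C : HAFormula) (σ : ℕ → Tm) :
    (friedman C A).subst σ = friedman (C.subst σ) (A.subst σ) := by
  induction A generalizing C σ <;> simp_all [subst, friedman, shift_subst_liftSubst]

theorem friedman_shift (A : Formula M) (C : HAFormula) :
    (friedman C A).shift = friedman C.shift A.shift :=
  friedman_subst A C _

theorem friedman_inst (A : Formula M) (C : HAFormula) (t : Tm) :
    (friedman C.shift A).inst t = friedman C (A.inst t) := by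
  rw [inst, friedman_subst]
  exact congrArg (friedman · _) (shift_inst C t)

theorem friedman_succInst (A : Formula M) (C : HAFormula) :
    (friedman C.shift A).succInst = friedman C.shift A.succInst := by
  rw [succInst, friedman_subst]
  exact congrArg (friedman · _) (shift_succInst C)

theorem map_friedman_shift (Γ : List (Formula M)) (C : HAFormula) :
    (Γ.map (friedman C)).map shift = (Γ.map shift).map (friedman C.shift) := by
  simp [Function.comp_def, friedman_shift]

end Formula

open Formula

/-! ### Intuitionistic reasoning under `C`-double negation -/

namespace HA

variable {M : Type} {Γ : List HAFormula} {A B C : HAFormula}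

theorem assume_head : HA (A :: Γ) A :=
  assume List.mem_cons_self

theorem weaken_cons (h : HA Γ A) : HA (B :: Γ) A :=
  weaken (List.subset_cons_self _ _) h

theorem imp_imp_of (h : HA Γ A) : HA Γ ((A.imp C).imp C) :=
  impI (impE h.weaken_cons assume_head)

theorem imp_of_imp_imp_imp (h : HA Γ (((A.imp C).imp C).imp C)) : HA Γ (A.imp C) :=
  impI (impE (imp_imp_of assume_head) h.weaken_cons)

theorem imp_imp_mono (h : HA Γ ((A.imp C).imp C)) (h' : HA (A :: Γ) B) :
    HA Γ ((B.imp C).imp C) := by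
  refine impI (impE (impI (impE (B := C) (A := B) ?_ ?_)) h.weaken_cons)
  · exact h'.weaken (List.cons_subset_cons _ (List.subset_cons_self _ _))
  · exact assume_head.weaken_cons

/-- In the scope of a new variable, an assumption `∀ x A` may be applied to that variable. -/
theorem of_all_shift_mem (h : A.all.shift ∈ Γ) : HA Γ A := by
  have := allE (Tm.v 0) (assume h)
  rwa [inst_shift_lift] at this

/-- Equations, `∨` and `∃` translate to formulas `X ⊃ C`, where triple `C`-negation collapses; `∧`,
`⊃`, `∀` inherit stability from their parts. This is what validates the classical rule. -/
theorem friedman_stable (A : Formula M) (C : HAFormula) (Γ : List HAFormula) :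
    HA Γ ((((friedman C A).imp C).imp C).imp (friedman C A)) := by
  induction A generalizing C Γ with
  | falsum => exact impI (impE (impI assume_head) assume_head)
  | eq s t => exact impI (imp_of_imp_imp_imp assume_head)
  | and A B ihA ihB =>
    exact impI (andI (impE (imp_imp_mono assume_head (andE₀ assume_head)) (ihA _ _))
      (impE (imp_imp_mono assume_head (andE₁ assume_head)) (ihB _ _)))
  | or A B => exact impI (imp_of_imp_imp_imp assume_head)
  | imp A B ihA ihB =>
    exact impI (impI (impE (imp_imp_mono assume_head.weaken_cons
      (impE assume_head.weaken_cons assume_head)) (ihB _ _)))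
  | ex A => exact impI (imp_of_imp_imp_imp assume_head)
  | all A ih =>
    exact impI (allI (impE (imp_imp_mono (A := (friedman C.shift A).all.shift) assume_head
      (of_all_shift_mem List.mem_cons_self)) (ih _ _)))
  | box m A ih => exact ih _ _

theorem friedman_bind {D : Formula M} (h : HA Γ ((A.imp C).imp C))
    (h' : HA (A :: Γ) (friedman C D)) : HA Γ (friedman C D) :=
  impE (imp_imp_mono h h') (friedman_stable D C Γ)

/-- Equational axioms gain a `C`-double negation, and induction for `A` becomes induction for its
translation. -/
theorem friedman_arith {A : Formula M} (h : ArithAxiom A) (C : HAFormula) :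
    HA Γ (friedman C A) := by
  induction h with
  | succ_ne_zero t =>
    exact impI (impE (impI (botI (impE assume_head (arith (.succ_ne_zero t))))) assume_head)
  | succ_inj t u =>
    exact impI (imp_imp_mono assume_head (impE assume_head (arith (.succ_inj t u))))
  | induction A =>
    have := arith (Γ := Γ) (.induction (friedman C.shift A))
    rwa [friedman_inst, friedman_succInst] at this
  | add_zero t => exact imp_imp_of (arith (.add_zero t))
  | add_succ t u => exact imp_imp_of (arith (.add_succ t u))
  | mul_zero t => exact imp_imp_of (arith (.mul_zero t))
  | mul_succ t u => exact imp_imp_of (arith (.mul_succ t u))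
  | proj i ts => exact imp_imp_of (arith (.proj i ts))
  | comp g h ts => exact imp_imp_of (arith (.comp g h ts))
  | prec_zero g h ts => exact imp_imp_of (arith (.prec_zero g h ts))
  | prec_succ g h u ts => exact imp_imp_of (arith (.prec_succ g h u ts))

end HA

/-! ### Soundness of the translations -/

/-- Soundness of the negative translation of epistemic arithmetic into Heyting arithmetic. -/
theorem EA.friedman {Γ : List EAFormula} {A : EAFormula} (h : EA Γ A) (C : HAFormula) :
    HA (Γ.map (Formula.friedman C)) (Formula.friedman C A) := by
  -- Rules with an eigenvariable use the induction hypothesis at `C.shift`.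
  induction h generalizing C with
  | assume h => exact .assume (List.mem_map_of_mem h)
  | weaken h _ ih => exact .weaken (List.map_subset _ h) (ih C)
  | andI _ _ ih₀ ih₁ => exact .andI (ih₀ C) (ih₁ C)
  | andE₀ _ ih => exact .andE₀ (ih C)
  | andE₁ _ ih => exact .andE₁ (ih C)
  | orI₀ _ ih => exact .impI (.impE (ih C).weaken_cons (.andE₀ HA.assume_head))
  | orI₁ _ ih => exact .impI (.impE (ih C).weaken_cons (.andE₁ HA.assume_head))
  | @orE Γ A B D _ _ _ ih ih₀ ih₁ =>
    -- The translated disjunction only eliminates into `C`, so the conclusion is first obtained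
    -- `C`-doubly negated; likewise for `∃`.
    refine HA.impE (.impI (.impE (.andI (.impI ?_) (.impI ?_)) (ih C).weaken_cons))
      (HA.friedman_stable D C _)
    · exact .impE ((ih₀ C).weaken (List.cons_subset_cons _ (List.subset_cons_self _ _)))
        HA.assume_head.weaken_cons
    · exact .impE ((ih₁ C).weaken (List.cons_subset_cons _ (List.subset_cons_self _ _)))
        HA.assume_head.weaken_cons
  | impI _ ih => exact .impI (ih C)
  | impE _ _ ih₀ ih₁ => exact .impE (ih₀ C) (ih₁ C)
  | @botC Γ A _ ih => exact .impE (.impI (ih C)) (HA.friedman_stable A C _)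
  | @exI Γ A t _ ih =>
    refine .impI (.impE (ih C).weaken_cons ?_)
    have := HA.allE t (HA.assume_head (Γ := Γ.map (Formula.friedman C))
      (A := (((Formula.friedman C.shift A).imp C.shift).all)))
    change HA _ (((Formula.friedman C.shift A).inst t).imp (C.shift.inst t)) at this
    rwa [friedman_inst, shift_inst] at this
  | @exE Γ A B _ _ ih₀ ih₁ =>
    refine HA.impE (.impI (.impE (.allI (.impI ?_)) (ih₀ C).weaken_cons))
      (HA.friedman_stable B C _)
    rw [List.map_cons, map_friedman_shift]
    have := ih₁ C.shift
    rw [← friedman_shift] at this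
    exact .impE (this.weaken (List.cons_subset_cons _ (List.subset_cons_self _ _)))
      HA.assume_head.weaken_cons
  | allI _ ih =>
    refine .allI ?_
    rw [map_friedman_shift]
    exact ih C.shift
  | @allE Γ A t _ ih =>
    rw [← friedman_inst]
    exact .allE t (ih C)
  | eqI t => exact HA.imp_imp_of (.eqI t)
  | @eqSub Γ A s t _ _ ih₀ ih₁ =>
    refine HA.friedman_bind (ih₀ C) ?_
    have := ih₁ C
    rw [← friedman_inst] at this ⊢
    exact .eqSub _ HA.assume_head this.weaken_cons
  -- With `□` erased, both modal rules become trivial.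
  | boxI _ _ ih => exact ih C
  | boxE _ ih => exact ih C
  | arith h => exact HA.friedman_arith h C

theorem ArithAxiom.ofHA {M : Type} {A : HAFormula} (h : ArithAxiom A) :
    ArithAxiom (Formula.ofHA A : Formula M) := by
  induction h with
  | induction A =>
    have := ArithAxiom.induction (Formula.ofHA A : Formula M)
    rwa [Formula.inst, succInst, ← ofHA_subst, ← ofHA_subst] at this
  | _ => constructor

theorem HA.toEA {Γ : List HAFormula} {A : HAFormula} (h : HA Γ A) :
    EA (Γ.map ofHA) (ofHA A) := by
  have map_shift (Γ : List HAFormula) :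
      (Γ.map shift).map ofHA = (Γ.map (ofHA (M := Unit))).map shift := by
    simp [Function.comp_def, shift, ofHA_subst]
  have ofHA_inst (A : HAFormula) (t : Tm) : (ofHA (A.inst t) : EAFormula) = (ofHA A).inst t :=
    ofHA_subst A _
  induction h with
  | assume h => exact .assume (List.mem_map_of_mem h)
  | weaken h _ ih => exact .weaken (List.map_subset _ h) ih
  | andI _ _ ih₀ ih₁ => exact .andI ih₀ ih₁
  | andE₀ _ ih => exact .andE₀ ih
  | andE₁ _ ih => exact .andE₁ ih
  | orI₀ _ ih => exact .orI₀ ih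
  | orI₁ _ ih => exact .orI₁ ih
  | orE _ _ _ ih ih₀ ih₁ => exact .orE ih ih₀ ih₁
  | impI _ ih => exact .impI ih
  | impE _ _ ih₀ ih₁ => exact .impE ih₀ ih₁
  | botI _ ih => exact .botC (.weaken (List.subset_cons_self _ _) ih)
  | exI t _ ih => exact .exI t (ofHA_inst _ t ▸ ih)
  | @exE Γ A B _ _ ih₀ ih₁ =>
    rw [List.map_cons, map_shift, shift, ofHA_subst] at ih₁
    exact .exE ih₀ ih₁
  | allI _ ih => exact .allI (map_shift _ ▸ ih)
  | allE t _ ih => exact ofHA_inst _ t ▸ .allE t ih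
  | eqI t => exact .eqI t
  | eqSub A _ _ ih₀ ih₁ =>
    rw [ofHA_inst] at ih₁ ⊢
    exact .eqSub _ ih₀ ih₁
  | arith h => exact .arith h.ofHA

/-! ### Transfer between EA and HA for `∃ y R(x, y)` -/

section graphZero

variable {M : Type} (f : FunSymb 2)

theorem subst_graphZero (σ : ℕ → Tm) :
    (graphZero f : Formula M).subst σ = Formula.eq (Tm.app f ![σ 1, σ 0]) Tm.zero := by
  refine congrArg₂ Formula.eq (congrArg (Tm.app f) ?_) (congrArg (Tm.app _) ?_)
  · funext i
    fin_cases i <;> rfl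
  · exact Subsingleton.elim _ _

/-- The substitution merges variables `0` and `1`, harmlessly, since only `x` is free here. -/
theorem ex_graphZero_inst_zero :
    (graphZero f : Formula M).ex.inst (Tm.v 0) = (graphZero f).ex :=
  congrArg Formula.ex (subst_graphZero f _)

/-- `R(x, y)` implies `∃ y R(x, y)`, in the scope of both `x` and `y`. -/
theorem HA.ex_graphZero_shift {Γ : List HAFormula} (h : HA Γ (graphZero f)) :
    HA Γ (graphZero f).ex.shift := by
  refine .exI (Tm.v 0) ?_
  rwa [inst_shift_lift]

end graphZero

theorem EA.nec_iff {A : EAFormula} : EA [] A.nec ↔ EA [] A :=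
  ⟨.boxE, .boxI (by simp)⟩

/-- Epistemic arithmetic is conservative over Heyting arithmetic for `□ ∀ x ∃ y R(x, y)`. -/
theorem EA_all_ex_iff (f : FunSymb 2) :
    EA [] (EAFormula.nec (graphZero f).ex.all) ↔ HA [] (graphZero f).ex.all := by
  rw [EA.nec_iff]
  refine ⟨fun h => .allI ?_, HA.toEA⟩
  have h' := EA.allE (Tm.v 0) h
  rw [ex_graphZero_inst_zero] at h'
  -- For this `C`, `R ⊃ C` is provable, hence so is `((R ⊃ C) ⊃ C) ⊃ C`, the antecedent in the
  -- translated `∃`.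
  refine HA.impE (.allI (.impI ?_)) (h'.friedman (graphZero f).ex)
  exact .impE (.impI (HA.ex_graphZero_shift f HA.assume_head)) HA.assume_head

/-- `□ ∀ x ◇ ∃ y R(x, y)` is provable in epistemic arithmetic if and only if
`∀ x ¬ ¬ ∃ y R(x, y)` is provable in Heyting arithmetic. -/
theorem EA_all_poss_ex_iff (f : FunSymb 2) :
    EA [] (EAFormula.nec (EAFormula.poss (graphZero f).ex).all) ↔
      HA [] (graphZero f).ex.neg.neg.all := by
  rw [EA.nec_iff]
  refine ⟨fun h => .allI (.impI ?_), fun h => .allI (.impI ?_)⟩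
  · have h' := EA.allE (Tm.v 0) h
    change EA [] ((EAFormula.nec
      (((graphZero f).ex.inst (Tm.v 0)).imp .falsum)).imp .falsum) at h'
    rw [ex_graphZero_inst_zero] at h'
    -- The translation of `◇ ∃ y R` is the double negation of that of `∃ y R`; the assumption `¬ ∃ y
    -- R` refutes the latter because it refutes each `R(x, y)`.
    refine .impE (.impI ?_) ((h'.friedman falsum).weaken (List.nil_subset _))
    refine .impE (.allI (.impI ?_)) HA.assume_head
    refine .impE (.impI ?_) HA.assume_head
    refine .impE (HA.ex_graphZero_shift f HA.assume_head) ?_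
    exact .assume (A := ((graphZero f).ex.neg).shift) (by simp)
  · have h' := (EA.allE (Tm.v 0) h.toEA)
    change EA [] ((((graphZero f).ex.inst (Tm.v 0)).imp .falsum).imp .falsum) at h'
    rw [ex_graphZero_inst_zero] at h'
    exact .impE (.boxE (.assume List.mem_cons_self)) (h'.weaken (List.nil_subset _))

end EpistemicArithmetic

theorem theorem4p2 :
    EpistemicArithmetic.EpistemicMarkovRule ↔ EpistemicArithmetic.MarkovRule :=
  forall_congr' fun f => imp_congr (EpistemicArithmetic.EA_all_poss_ex_iff f)
    (EpistemicArithmetic.EA_all_ex_iff f)
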